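/- Consider a synchronous network on $n$ nodes with distinct identifiers $1,\dots,n$. Its topology is an arbitrary sequence of graphs $G_0,G_1,G_2,\dots$ on these nodes, where $G_i$ is the graph at the beginning of round $i$; thus arbitrarily many edges may be inserted and deleted concurrently in each round $i\ge 1$, the changed edges being $F_i=E(G_{i-1})\,\triangle\,E(G_i)$. Each node knows $n$, its identifier, its initial neighborhood and label, and the round number. In each round $i\ge 1$ every node first receives indications of the insertions and deletions of its own incident edges (only after they occurred), performs local computation, sends a message to each of its neighbors in $G_i$, receives the messages sent to it in this round, and performs local computation. Each node $v$ stores a label $L_v$, which is either "unmatched" or "matched-to-$u$" for a node $u$. The labeled star of $v$ is consistent (with respect to a graph) if: whenever $L_v$ is matched-to-$u$, then $u$ is a neighbor of $v$ and $L_u$ is matched-to-$v$; whenever a neighbor $u$ of $v$ has $L_u$ equal to matched-to-$v$, then $L_v$ is matched-to-$u$; and if $v$ is unmatched then no neighbor of $v$ is unmatched. (All stars are consistent if and only if the labels describe a maximal matching.) The labels in round $0$ are such that all stars are consistent with respect to $G_0$ (for instance, $G_0$ is empty and all nodes are unmatched). A star is called inconsistent in round $i$ if it is inconsistent with respect to $G_i$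 at the beginning of round $i$ or at its end. Let $\mathrm{changes}(i)=\sum_{1\le j\le i}|F_j|$, and let $\mathrm{incorrect}(i)$ be the number of rounds $j\le i$ in which at least one star is inconsistent. A change of an edge touches the neighborhood of $v$ if at least one endpoint of the edge is $v$ or a neighbor of $v$. Theorem. There are a deterministic distributed algorithm and absolute constants $c,k,K$ such that for all $n$, all its messages consist of at most $c\lfloor\log_2 n\rfloor$ bits, and for every dynamic network $G_0,G_1,\dots$ on $n$ nodes and every initial labeling that is consistent for all stars: 1. (amortized complexity $O(1)$) $\mathrm{incorrect}(i)/\mathrm{changes}(i)\le k$ for every round $i$ with $\mathrm{changes}(i)>0$; 2. (worst-case fixing time $O(n)$) if the star of $v$ is inconsistent in each of the rounds $a,a+1,\dots,b$, and no topology change in the rounds $a+1,\dots,b$ touches the neighborhood of $v$, then $b-a+1\le Kn$; 3. (consistent stars stay consistent) if the star of $v$ is consistent at the end of round $a$, and no topology change in the rounds $a+1,\dots,b$ touches the neighborhood of $v$, then the star of $v$ is consistent at the end of round $b$. -/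

import Mathlib

namespace DynamicMatching

/-! Nodes are `Fin n`; the element of `Fin n` is the unique identifier of the node.
A dynamic network is a sequence `G : ℕ → SimpleGraph (Fin n)`: `G 0` is the initial graph (round `0`),
and `G i` is the graph at the beginning of round `i`, after the topology changes of that round. -/

/-- The label of a node for the matching problem. -/
inductive Label (n : ℕ) where
  | unmatched : Label n
  | matchedTo (u : Fin n) : Label n

/-- The labeled star centered at `v` is consistent: if `v` is matched to `u` then `u` is a neighbor
that is matched to `v`; a neighbor that is matched to `v` is the one that `v` is matched to;
and if `v` is unmatched then it has no unmatched neighbor. -/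
def StarConsistent {n : ℕ} (H : SimpleGraph (Fin n)) (L : Fin n → Label n) (v : Fin n) : Prop :=
  (∀ u, L v = Label.matchedTo u → H.Adj v u ∧ L u = Label.matchedTo v) ∧
  (∀ u, H.Adj v u → L u = Label.matchedTo v → L v = Label.matchedTo u) ∧
  (L v = Label.unmatched → ∀ u, H.Adj v u → L u ≠ Label.unmatched)

/-- A deterministic synchronous message-passing algorithm on `n` nodes. A node stores its label and
a local memory. It always knows its identifier `v`, the number `n`, and the round number. -/
structure Algorithm (n : ℕ) where
  /-- The local memory of a node. -/
  Mem : Type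
  /-- The initial memory of `v`, from its initial neighborhood and its initial label. -/
  init : (v : Fin n) → (nbrs : Set (Fin n)) → Label n → Mem
  /-- Local computation at the beginning of a round: `v` has received the indications that its edges
  to the nodes in `ins` were inserted and its edges to the nodes in `del` were deleted. -/
  notify : (round : ℕ) → (v : Fin n) → (ins del : Set (Fin n)) → Label n × Mem → Label n × Mem
  /-- The bit string that `v` sends to its neighbor `w` in a round (the empty string for silence). -/
  send : (round : ℕ) → (v : Fin n) → Label n × Mem → (w : Fin n) → List Bool
  /-- Local computation at the end of a round, from the messages received by `v`, indexed by the
  sender; there is `none` for the nodes that are not neighbors of `v` in this round. -/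
  receive : (round : ℕ) → (v : Fin n) → (inbox : Fin n → Option (List Bool)) →
    Label n × Mem → Label n × Mem

namespace Algorithm

variable {n : ℕ}

/-- The stored information of every node after the indications of a round in which the graph changed
from `H` to `H'`, and before the communication of this round. -/
def afterNotify (A : Algorithm n) (round : ℕ) (H H' : SimpleGraph (Fin n))
    (s : Fin n → Label n × A.Mem) : Fin n → Label n × A.Mem :=
  fun v => A.notify round v (H'.neighborSet v \ H.neighborSet v)
    (H.neighborSet v \ H'.neighborSet v) (s v)

open Classical in
/-- One full round: indications, local computation, exchange of messages along the edges of the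
current graph `H'`, local computation. -/
noncomputable def runRound (A : Algorithm n) (round : ℕ) (H H' : SimpleGraph (Fin n))
    (s : Fin n → Label n × A.Mem) : Fin n → Label n × A.Mem :=
  fun v => A.receive round v
    (fun w => if H'.Adj w v then some (A.send round w (A.afterNotify round H H' s w) v) else none)
    (A.afterNotify round H H' s v)

/-- The stored information of every node at the end of round `i`, in the execution on the dynamic
network `G` with initial labels `L₀`. Nothing happens in round `0`. -/
noncomputable def config (A : Algorithm n) (G : ℕ → SimpleGraph (Fin n)) (L₀ : Fin n → Label n) :
    ℕ → Fin n → Label n × A.Mem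
  | 0 => fun v => (L₀ v, A.init v ((G 0).neighborSet v) (L₀ v))
  | i + 1 => A.runRound (i + 1) (G i) (G (i + 1)) (A.config G L₀ i)

/-- The labels at the end of round `i`. -/
noncomputable def labels (A : Algorithm n) (G : ℕ → SimpleGraph (Fin n)) (L₀ : Fin n → Label n)
    (i : ℕ) : Fin n → Label n :=
  fun v => (A.config G L₀ i v).1

/-- Every message consists of at most `b` bits. -/
def MessagesAtMost (A : Algorithm n) (b : ℕ) : Prop :=
  ∀ round v s w, (A.send round v s w).length ≤ b

end Algorithm

variable {n : ℕ}

/-- The edges that are inserted or deleted in round `i` (none in round `0`, where `i - 1 = 0`). -/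
def changedEdges (G : ℕ → SimpleGraph (Fin n)) (i : ℕ) : Set (Sym2 (Fin n)) :=
  symmDiff (G (i - 1)).edgeSet (G i).edgeSet

/-- The number of topology changes that occurred until round `i`. -/
noncomputable def changes (G : ℕ → SimpleGraph (Fin n)) (i : ℕ) : ℕ :=
  ∑ j ∈ Finset.range (i + 1), (changedEdges G j).ncard

/-- A topology change of round `i` touches the 1-hop neighborhood of `v`: a changed edge has an
endpoint that is `v` or a neighbor of `v`. -/
def TouchedInRound (G : ℕ → SimpleGraph (Fin n)) (i : ℕ) (v : Fin n) : Prop :=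
  ∃ e ∈ changedEdges G i, ∃ a ∈ e, a = v ∨ (G i).Adj v a

/-- The star of `v` is inconsistent in round `i`: at the beginning of the round (in the new graph,
with the labels with which the previous round ended) or at the end of the round. -/
def InconsistentInRound (A : Algorithm n) (G : ℕ → SimpleGraph (Fin n)) (L₀ : Fin n → Label n)
    (i : ℕ) (v : Fin n) : Prop :=
  ¬ StarConsistent (G i) (A.labels G L₀ (i - 1)) v ∨ ¬ StarConsistent (G i) (A.labels G L₀ i) v

/-- The number of rounds until round `i` in which there is at least one inconsistent star. -/
noncomputable def incorrect (A : Algorithm n) (G : ℕ → SimpleGraph (Fin n))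
    (L₀ : Fin n → Label n) (i : ℕ) : ℕ :=
  {j : ℕ | j ≤ i ∧ ∃ v, InconsistentInRound A G L₀ j v}.ncard

/-- The amortized round complexity of the execution is at most `k`. -/
def AmortizedAtMost (A : Algorithm n) (G : ℕ → SimpleGraph (Fin n)) (L₀ : Fin n → Label n)
    (k : ℕ) : Prop :=
  ∀ i, 0 < changes G i → (incorrect A G L₀ i : ℚ) / (changes G i : ℚ) ≤ k

/-- Every fixing process takes at most `k` rounds: if the star of `v` is inconsistent in all of the
rounds `a, …, b`, and no topology change touches the neighborhood of `v` in the rounds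
`a + 1, …, b`, then these are at most `k` rounds. -/
def WorstCaseAtMost (A : Algorithm n) (G : ℕ → SimpleGraph (Fin n)) (L₀ : Fin n → Label n)
    (k : ℕ) : Prop :=
  ∀ (v : Fin n) (a b : ℕ), a ≤ b →
    (∀ i, a ≤ i → i ≤ b → InconsistentInRound A G L₀ i v) →
    (∀ i, a < i → i ≤ b → ¬ TouchedInRound G i v) →
    b - a + 1 ≤ k

/-- A star that is consistent at the end of a round stays consistent as long as no topology change
touches the neighborhood of its center. -/
def ConsistentStarsPersist (A : Algorithm n) (G : ℕ → SimpleGraph (Fin n))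
    (L₀ : Fin n → Label n) : Prop :=
  ∀ (v : Fin n) (a b : ℕ), a ≤ b → StarConsistent (G a) (A.labels G L₀ a) v →
    (∀ i, a < i → i ≤ b → ¬ TouchedInRound G i v) →
    StarConsistent (G b) (A.labels G L₀ b) v

end DynamicMatching

namespace DynamicMatching

/-! Both endpoints of a deleted matched edge drop it at once, and only mutual proposals create
matches, so at the end of every round the labels form a matching of the current graph
(`IsValid.runRound`). A star is then inconsistent exactly when its center lies on a free edge, one
with both ends unmatched. Away from topology changes no node becomes unmatched, so consistent stars
persist.

In an even round, an unmatched node that outranks its rivals is chosen by all its free neighbors,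
hence its own choice is mutual. The rotation gives every node top priority within `2 * n` rounds,
which bounds the fixing time. Globally, the highest node on a free edge is always matched in a quiet
even round (`exists_isMutual_of_quiet`). The amortized bound uses as potential the size of a vertex
cover of the free edges: a changed edge adds at most two nodes, a match removes one, and a match
costs at most two quiet rounds (`exists_isFreeCover`). -/

open Classical in
/-- The label of a node after the deletion of its edges to the nodes in `del`. -/
noncomputable def dropDeleted {n : ℕ} (del : Set (Fin n)) (L : Label n) : Label n :=
  if ∃ u ∈ del, L = Label.matchedTo u then Label.unmatched else L

/-- The priority of a node in a round. It rotates, so that every node has the highest priority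
`n - 1` once in `n` consecutive phases of two rounds. -/
def priority {n : ℕ} (round : ℕ) (w : Fin n) : ℕ := (w + round / 2) % n

/-- `u` is the node of highest priority in `S`. -/
def IsChosen {n : ℕ} (round : ℕ) (S : Set (Fin n)) (u : Fin n) : Prop :=
  u ∈ S ∧ ∀ w ∈ S, priority round w ≤ priority round u

open Classical in
/-- The rotating-priority matching algorithm. In odd rounds the unmatched nodes announce
themselves, and every node stores its unmatched neighbors. In even rounds every unmatched node
proposes to the stored neighbor of highest priority, and mutual proposals become matched. A node
whose matched edge is deleted becomes unmatched at once. -/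
noncomputable def rotating (n : ℕ) : Algorithm n where
  Mem := Set (Fin n)
  init _ _ _ := ∅
  notify _ _ _ del s := (dropDeleted del s.1, s.2)
  send round _ s w :=
    -- The guard keeps the single node silent for `n = 1`, where the bound `Nat.log 2 n` is `0`.
    if 2 ≤ n ∧ s.1 = Label.unmatched ∧ (Even round → IsChosen round s.2 w) then [true] else []
  receive round _ inbox s :=
    if Even round then
      (if h : s.1 = Label.unmatched ∧ ∃ u, IsChosen round s.2 u ∧ inbox u = some [true]
        then Label.matchedTo h.2.choose else s.1, s.2)
    else (s.1, {w | inbox w = some [true]})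

variable {n : ℕ}

lemma priority_lt (r : ℕ) (w : Fin n) : priority r w < n := Nat.mod_lt _ w.pos

lemma priority_injective (r : ℕ) : Function.Injective (priority (n := n) r) := by
  intro a b h
  have h' : (a : ℕ) ≡ b [MOD n] := Nat.ModEq.add_right_cancel' (r / 2) h
  exact Fin.ext (Nat.ModEq.eq_of_lt_of_lt h' a.2 b.2)

lemma IsChosen.unique {r : ℕ} {S : Set (Fin n)} {u w : Fin n} (hu : IsChosen r S u)
    (hw : IsChosen r S w) : u = w :=
  priority_injective r (le_antisymm (hw.2 u hu.1) (hu.2 w hw.1))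

lemma exists_isChosen (r : ℕ) {S : Set (Fin n)} (hS : S.Nonempty) : ∃ u, IsChosen r S u :=
  S.toFinite.exists_maximalFor (priority r) S hS |>.imp fun _ hu =>
    ⟨hu.1, fun _ hw => (le_total _ _).elim id fun h => hu.2 hw h⟩

lemma two_le_of_adj {H : SimpleGraph (Fin n)} {v u : Fin n} (h : H.Adj v u) : 2 ≤ n := by
  have := Fin.val_ne_of_ne h.ne
  omega

lemma dropDeleted_unmatched (del : Set (Fin n)) :
    dropDeleted del Label.unmatched = Label.unmatched := by
  simp [dropDeleted]

lemma dropDeleted_empty (L : Label n) : dropDeleted ∅ L = L := by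
  simp [dropDeleted]

lemma dropDeleted_eq_matchedTo {del : Set (Fin n)} {L : Label n} {u : Fin n} :
    dropDeleted del L = Label.matchedTo u ↔ L = Label.matchedTo u ∧ u ∉ del := by
  unfold dropDeleted
  split_ifs with h
  · obtain ⟨w, hw, rfl⟩ := h
    simp only [Label.matchedTo.injEq, false_iff, not_and, not_not]
    rintro rfl
    exact hw
  · push Not at h
    exact ⟨fun hL => ⟨hL, fun hu => h u hu hL⟩, And.left⟩

/-! ### Matchings and free edges -/

/-- The labels describe a matching of `H`. -/
def IsValid (H : SimpleGraph (Fin n)) (L : Fin n → Label n) : Prop :=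
  ∀ v u, L v = Label.matchedTo u → H.Adj v u ∧ L u = Label.matchedTo v

/-- The nodes `v` and `u` are adjacent and both unmatched. -/
def IsFreeEdge (H : SimpleGraph (Fin n)) (L : Fin n → Label n) (v u : Fin n) : Prop :=
  H.Adj v u ∧ L v = Label.unmatched ∧ L u = Label.unmatched

lemma IsFreeEdge.symm {H : SimpleGraph (Fin n)} {L : Fin n → Label n} {v u : Fin n}
    (h : IsFreeEdge H L v u) : IsFreeEdge H L u v := ⟨h.1.symm, h.2.2, h.2.1⟩

lemma IsValid.starConsistent_iff {H : SimpleGraph (Fin n)} {L : Fin n → Label n}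
    (hL : IsValid H L) (v : Fin n) : StarConsistent H L v ↔ ∀ u, ¬ IsFreeEdge H L v u := by
  refine ⟨fun h u hu => h.2.2 hu.2.1 u hu.1 hu.2.2,
    fun h => ⟨hL v, fun u _ hu => (hL u v hu).2, fun hv u hu hu' => h u ⟨hu, hv, hu'⟩⟩⟩

lemma isValid_of_starConsistent {H : SimpleGraph (Fin n)} {L : Fin n → Label n}
    (h : ∀ v, StarConsistent H L v) : IsValid H L := fun v => (h v).1

/-! ### Analysis of a single round -/

section Round

variable (r : ℕ) (H H' : SimpleGraph (Fin n)) (s : Fin n → Label n × Set (Fin n))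

/-- The labels after the indications of a round in which the graph changed from `H` to `H'`. -/
noncomputable def notifiedLabels (L : Fin n → Label n) : Fin n → Label n :=
  fun v => dropDeleted (H.neighborSet v \ H'.neighborSet v) (L v)

/-- The edge between `v` and `u` is proposed by both of its endpoints in an even round. -/
def IsMutual (v u : Fin n) : Prop :=
  IsFreeEdge H' (notifiedLabels H H' fun w => (s w).1) v u ∧
    IsChosen r (s v).2 u ∧ IsChosen r (s u).2 v

variable {r H H' s}

lemma IsMutual.symm {v u : Fin n} (h : IsMutual r H H' s v u) : IsMutual r H H' s u v :=
  ⟨h.1.symm, h.2.2, h.2.1⟩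

lemma IsMutual.unique {v u w : Fin n} (h : IsMutual r H H' s v u) (h' : IsMutual r H H' s v w) :
    u = w := h.2.1.unique h'.2.1

lemma runRound_of_odd (hr : ¬ Even r) (v : Fin n) :
    (rotating n).runRound r H H' s v =
      (notifiedLabels H H' (fun w => (s w).1) v,
        {w | H'.Adj w v ∧ notifiedLabels H H' (fun w => (s w).1) w = Label.unmatched}) := by
  simp only [Algorithm.runRound, Algorithm.afterNotify, rotating, hr, notifiedLabels, if_false,
    Prod.mk.injEq, true_and, false_imp_iff, and_true]
  ext w
  simp only [Set.mem_ofPred_eq]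
  by_cases hw : H'.Adj w v
  · simp [hw, two_le_of_adj hw, hr]
  · simp [hw]

lemma inbox_eq_iff (hr : Even r) (v u : Fin n) :
    (notifiedLabels H H' (fun w => (s w).1) v = Label.unmatched ∧ IsChosen r (s v).2 u ∧
      (open Classical in if H'.Adj u v then
        some ((rotating n).send r u ((rotating n).afterNotify r H H' s u) v) else none) =
          some [true]) ↔ IsMutual r H H' s v u := by
  by_cases hw : H'.Adj u v
  · simp only [Algorithm.afterNotify, rotating, hr, hw, notifiedLabels, IsMutual, IsFreeEdge,
      if_true, two_le_of_adj hw, hw.symm, true_and, true_imp_iff, Option.some.injEq]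
    simp only [ite_eq_left_iff, reduceCtorEq, imp_false, not_not, List.nil_eq]
    have := two_le_of_adj hw
    tauto
  · have : ¬ H'.Adj v u := fun h => hw h.symm
    simp [hw, this, IsMutual, IsFreeEdge]

lemma runRound_fst_of_even (hr : Even r) (v : Fin n) :
    (∃ u, IsMutual r H H' s v u ∧
      ((rotating n).runRound r H H' s v).1 = Label.matchedTo u) ∨
    ((∀ u, ¬ IsMutual r H H' s v u) ∧
      ((rotating n).runRound r H H' s v).1 = notifiedLabels H H' (fun w => (s w).1) v) := by
  have key := inbox_eq_iff (H := H) (H' := H') (s := s) hr v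
  have hrun : ((rotating n).runRound r H H' s v).1 = (open Classical in
      if h : notifiedLabels H H' (fun w => (s w).1) v = Label.unmatched ∧ ∃ u,
        IsChosen r (s v).2 u ∧ (if H'.Adj u v then
        some ((rotating n).send r u ((rotating n).afterNotify r H H' s u) v) else none) =
          some [true]
      then Label.matchedTo h.2.choose else notifiedLabels H H' (fun w => (s w).1) v) := by
    change (if Even r then _ else _ : Label n × Set (Fin n)).1 = _
    rw [if_pos hr]
    rfl
  rw [hrun]
  split_ifs with h
  · exact Or.inl ⟨_, (key _).1 ⟨h.1, h.2.choose_spec⟩, rfl⟩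
  · refine Or.inr ⟨fun u hu => h ?_, rfl⟩
    have := (key u).2 hu
    exact ⟨this.1, u, this.2⟩

lemma IsMutual.runRound_fst (hr : Even r) {v u : Fin n} (h : IsMutual r H H' s v u) :
    ((rotating n).runRound r H H' s v).1 = Label.matchedTo u := by
  rcases runRound_fst_of_even (H := H) (H' := H') (s := s) hr v with ⟨w, hw, h'⟩ | ⟨h', -⟩
  · rw [h', h.unique hw]
  · exact absurd h (h' u)

/-- Both endpoints of a deleted edge are notified in the same round, so partners are reset together.
-/
lemma IsValid.notifiedLabels {L : Fin n → Label n} (hL : IsValid H L) :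
    IsValid H' (notifiedLabels H H' L) := by
  intro v u h
  obtain ⟨h1, h2⟩ := dropDeleted_eq_matchedTo.1 h
  obtain ⟨h3, h4⟩ := hL v u h1
  have h5 : H'.Adj v u := by_contra fun h5 => h2 ⟨h3, h5⟩
  exact ⟨h5, dropDeleted_eq_matchedTo.2 ⟨h4, fun h6 => h6.2 h5.symm⟩⟩

/-- A round changes the labels after the indications only by matching free nodes. -/
lemma runRound_fst_of_notifiedLabels_ne {v : Fin n}
    (hv : notifiedLabels H H' (fun w => (s w).1) v ≠ Label.unmatched) :
    ((rotating n).runRound r H H' s v).1 = notifiedLabels H H' (fun w => (s w).1) v := by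
  by_cases hr : Even r
  · rcases runRound_fst_of_even (H := H) (H' := H') (s := s) hr v with ⟨w, hw, -⟩ | ⟨-, h⟩
    · exact absurd hw.1.2.1 hv
    · exact h
  · rw [runRound_of_odd hr]

lemma IsValid.runRound (hL : IsValid H fun w => (s w).1) :
    IsValid H' fun w => ((rotating n).runRound r H H' s w).1 := by
  have hN := hL.notifiedLabels (H' := H')
  by_cases hr : Even r
  · intro v u h
    dsimp only at h ⊢
    rcases runRound_fst_of_even (H := H) (H' := H') (s := s) hr v with ⟨w, hw, h'⟩ | ⟨-, h'⟩
    · obtain rfl : w = u := by simpa using h'.symm.trans h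
      exact ⟨hw.1.1, hw.symm.runRound_fst hr⟩
    · obtain ⟨h1, h2⟩ := hN v u (h'.symm.trans h)
      exact ⟨h1, by rw [runRound_fst_of_notifiedLabels_ne (by simp [h2]), h2]⟩
  · simpa only [runRound_of_odd hr] using hN

/-- A free node all of whose free neighbors have stored it as their neighbor of highest priority
becomes matched in an even round. -/
lemma exists_isMutual {v : Fin n}
    (hv : (s v).1 = Label.unmatched) (hne : (s v).2.Nonempty)
    (h : ∀ u ∈ (s v).2, H'.Adj v u ∧ (s u).1 = Label.unmatched ∧ IsChosen r (s u).2 v) :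
    ∃ u, IsMutual r H H' s v u := by
  obtain ⟨u, hu⟩ := exists_isChosen r hne
  obtain ⟨h1, h2, h3⟩ := h u hu.1
  -- Indications never affect an unmatched label, so the labels before the round suffice.
  exact ⟨u, ⟨h1, by simp [notifiedLabels, hv, dropDeleted_unmatched],
    by simp [notifiedLabels, h2, dropDeleted_unmatched]⟩, hu, h3⟩

lemma notifiedLabels_self (L : Fin n → Label n) : notifiedLabels H H L = L := by
  ext v
  simp [notifiedLabels, dropDeleted_empty]

end Round

/-! ### Topology changes -/

section Changes

variable {G : ℕ → SimpleGraph (Fin n)} {i : ℕ}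

lemma mem_changedEdges_succ {a b : Fin n} :
    s(a, b) ∈ changedEdges G (i + 1) ↔ ¬ ((G (i + 1)).Adj a b ↔ (G i).Adj a b) := by
  simp only [changedEdges, Set.mem_symmDiff, Nat.add_sub_cancel, SimpleGraph.mem_edgeSet]
  tauto

lemma adj_iff_of_not_touched {v : Fin n} (h : ¬ TouchedInRound G (i + 1) v) (u : Fin n) :
    (G (i + 1)).Adj v u ↔ (G i).Adj v u := by
  by_contra hc
  exact h ⟨s(v, u), mem_changedEdges_succ.2 hc, v, Sym2.mem_mk_left _ _, Or.inl rfl⟩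

lemma adj_iff_of_not_touched_of_adj {v u : Fin n} (h : ¬ TouchedInRound G (i + 1) v)
    (hu : (G (i + 1)).Adj v u) (w : Fin n) : (G (i + 1)).Adj u w ↔ (G i).Adj u w := by
  by_contra hc
  exact h ⟨s(u, w), mem_changedEdges_succ.2 hc, u, Sym2.mem_mk_left _ _, Or.inr hu⟩

lemma eq_of_ncard_changedEdges_eq_zero (h : (changedEdges G (i + 1)).ncard = 0) :
    G (i + 1) = G i := by
  rw [Set.ncard_eq_zero (Set.toFinite _)] at h
  ext a b
  by_contra hc
  exact (h ▸ mem_changedEdges_succ.2 hc : s(a, b) ∈ (∅ : Set (Sym2 (Fin n))))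

lemma changes_succ (G : ℕ → SimpleGraph (Fin n)) (i : ℕ) :
    changes G (i + 1) = changes G i + (changedEdges G (i + 1)).ncard :=
  Finset.sum_range_succ _ _

lemma StarConsistent.congr {H H' : SimpleGraph (Fin n)} {L : Fin n → Label n} {v : Fin n}
    (h : StarConsistent H L v) (hH : ∀ u, H'.Adj v u ↔ H.Adj v u) : StarConsistent H' L v := by
  simpa only [StarConsistent, hH] using h

lemma notifiedLabels_of_adj_iff {H H' : SimpleGraph (Fin n)} {v : Fin n}
    (h : ∀ u, H'.Adj v u ↔ H.Adj v u) (L : Fin n → Label n) : notifiedLabels H H' L v = L v := by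
  have : H.neighborSet v \ H'.neighborSet v = ∅ :=
    Set.sdiff_eq_empty.2 fun u hu => (h u).2 hu
  rw [notifiedLabels, this, dropDeleted_empty]

end Changes

/-! ### Invariants of an execution -/

section Execution

variable {G : ℕ → SimpleGraph (Fin n)} {L₀ : Fin n → Label n}

lemma labels_succ (i : ℕ) (v : Fin n) : (rotating n).labels G L₀ (i + 1) v =
    ((rotating n).runRound (i + 1) (G i) (G (i + 1)) ((rotating n).config G L₀ i) v).1 := rfl

lemma isValid_labels (h0 : ∀ v, StarConsistent (G 0) L₀ v) (i : ℕ) :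
    IsValid (G i) ((rotating n).labels G L₀ i) := by
  induction i with
  | zero => exact isValid_of_starConsistent h0
  | succ i ih => exact IsValid.runRound ih

lemma labels_succ_of_odd {i : ℕ} (hi : ¬ Even (i + 1)) (v : Fin n) :
    (rotating n).labels G L₀ (i + 1) v =
      notifiedLabels (G i) (G (i + 1)) ((rotating n).labels G L₀ i) v :=
  congrArg Prod.fst (runRound_of_odd hi v)

/-- At the end of an odd round every node has stored its unmatched neighbors. -/
lemma config_snd_of_odd {i : ℕ} (hi : ¬ Even i) (v : Fin n) :
    ((rotating n).config G L₀ i v).2 =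
      {w | (G i).Adj w v ∧ (rotating n).labels G L₀ i w = Label.unmatched} := by
  obtain _ | i := i
  · simp at hi
  · simp only [labels_succ_of_odd hi]
    exact congrArg Prod.snd (runRound_of_odd hi v)

lemma labels_succ_eq_of_ne {i : ℕ} {v : Fin n} (h : ∀ u, (G (i + 1)).Adj v u ↔ (G i).Adj v u)
    (hv : (rotating n).labels G L₀ i v ≠ Label.unmatched) :
    (rotating n).labels G L₀ (i + 1) v = (rotating n).labels G L₀ i v := by
  have h' := notifiedLabels_of_adj_iff h ((rotating n).labels G L₀ i)
  exact (runRound_fst_of_notifiedLabels_ne (h'.trans_ne hv)).trans h'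

/-- A free edge at `v` after the round was already free before it: the neighborhoods of `v` and its
neighbors are unchanged, so none of these nodes lost a partner. -/
lemma starConsistent_succ (h0 : ∀ v, StarConsistent (G 0) L₀ v) {i : ℕ} {v : Fin n}
    (h : StarConsistent (G i) ((rotating n).labels G L₀ i) v)
    (ht : ¬ TouchedInRound G (i + 1) v) :
    StarConsistent (G (i + 1)) ((rotating n).labels G L₀ (i + 1)) v := by
  rw [(isValid_labels h0 _).starConsistent_iff] at h ⊢
  rintro u ⟨hadj, hv, hu⟩
  refine h u ⟨(adj_iff_of_not_touched ht u).1 hadj, by_contra fun hne => hne ?_,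
    by_contra fun hne => hne ?_⟩
  · rw [← labels_succ_eq_of_ne (adj_iff_of_not_touched ht) hne, hv]
  · rw [← labels_succ_eq_of_ne (adj_iff_of_not_touched_of_adj ht hadj) hne, hu]

theorem consistentStarsPersist_rotating (h0 : ∀ v, StarConsistent (G 0) L₀ v) :
    ConsistentStarsPersist (rotating n) G L₀ := by
  intro v a b hab ha ht
  induction b, hab using Nat.le_induction with
  | base => exact ha
  | succ b hab ih =>
    exact starConsistent_succ h0 (ih fun i h h' => ht i h (h'.trans b.le_succ))
      (ht _ (Nat.lt_succ_of_le hab) le_rfl)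

/-! ### Worst-case fixing time -/

lemma exists_highest_priority (a : ℕ) (v : Fin n) :
    ∃ i, a ≤ i ∧ i < a + 2 * n ∧ ¬ Even i ∧
      ∀ w : Fin n, priority (i + 1) w ≤ priority (i + 1) v := by
  have hn : 0 < n := v.pos
  -- Among `n` consecutive phases `q`, one has `v + q` congruent to `n - 1`; its even round is `2 *
  -- q`, and `i = 2 * q - 1` precedes it.
  obtain ⟨q, hq1, hq2, hq⟩ : ∃ q, a / 2 + 1 ≤ q ∧ q ≤ a / 2 + n ∧ (v + q) % n = n - 1 := by
    set m := (v + a / 2 + 1) % n with hm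
    have hmn : m < n := Nat.mod_lt _ hn
    refine ⟨a / 2 + 1 + (n - 1 - m), by omega, by omega, ?_⟩
    have : (v : ℕ) + (a / 2 + 1 + (n - 1 - m)) = (v + a / 2 + 1) + (n - 1 - m) := by ring
    rw [this, Nat.add_mod, ← hm, Nat.mod_eq_of_lt (by omega : n - 1 - m < n),
      Nat.mod_eq_of_lt (by omega)]
    omega
  refine ⟨2 * q - 1, by omega, by omega, by rw [Nat.not_even_iff]; omega, fun w => ?_⟩
  have h2 : (2 * q - 1 + 1) / 2 = q := by omega
  have h3 : priority (2 * q - 1 + 1) v = n - 1 := by rw [priority, h2, hq]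
  have := priority_lt (2 * q - 1 + 1) w
  omega

lemma starConsistent_succ_of_highest_priority (h0 : ∀ v, StarConsistent (G 0) L₀ v) {i : ℕ}
    {v : Fin n} (hi : ¬ Even i) (ht : ¬ TouchedInRound G (i + 1) v)
    (hv : ∀ w : Fin n, priority (i + 1) w ≤ priority (i + 1) v) :
    StarConsistent (G (i + 1)) ((rotating n).labels G L₀ (i + 1)) v := by
  by_cases hc : StarConsistent (G i) ((rotating n).labels G L₀ i) v
  · exact starConsistent_succ h0 hc ht
  rw [(isValid_labels h0 _).starConsistent_iff] at hc ⊢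
  push Not at hc
  obtain ⟨u, hu⟩ := hc
  obtain ⟨w, hw⟩ : ∃ w, IsMutual (i + 1) (G i) (G (i + 1)) ((rotating n).config G L₀ i) v w := by
    refine exists_isMutual hu.2.1 ?_ ?_
    · rw [config_snd_of_odd hi]
      exact ⟨u, hu.1.symm, hu.2.2⟩
    · intro w hw
      rw [config_snd_of_odd hi] at hw ⊢
      exact ⟨(adj_iff_of_not_touched ht w).2 hw.1.symm, hw.2, ⟨hw.1.symm, hu.2.1⟩, fun x _ => hv x⟩
  rintro x ⟨-, hx, -⟩
  rw [labels_succ, hw.runRound_fst (Nat.even_add_one.2 hi)] at hx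
  cases hx

theorem worstCaseAtMost_rotating (h0 : ∀ v, StarConsistent (G 0) L₀ v) :
    WorstCaseAtMost (rotating n) G L₀ (3 * n) := by
  intro v a b hab hinc ht
  by_contra hlt
  have hn := v.pos
  obtain ⟨i, hai, hi, hodd, hpr⟩ := exists_highest_priority a v
  have hc := starConsistent_succ_of_highest_priority h0 hodd (ht _ (by omega) (by omega)) hpr
  -- Round `i + 1` may still start inconsistent, so the contradiction comes from the round after it.
  -- Thus `b - a + 1` is at most `2 * n + 1`, hence at most `3 * n`.
  have ht' := ht (i + 1 + 1) (by omega) (by omega)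
  rcases hinc (i + 1 + 1) (by omega) (by omega) with h | h
  · exact h (hc.congr (adj_iff_of_not_touched ht'))
  · exact h (starConsistent_succ h0 hc ht')

/-! ### Amortized complexity -/

/-- Every edge between unmatched nodes has an endpoint in `C`. -/
def IsFreeCover (H : SimpleGraph (Fin n)) (L : Fin n → Label n) (C : Finset (Fin n)) : Prop :=
  ∀ v u, IsFreeEdge H L v u → v ∈ C ∨ u ∈ C

/-- Adding all endpoints of changed edges suffices: a newly free edge was either inserted or has an
end that lost its matched edge. -/
lemma IsFreeCover.exists_notifiedLabels {i : ℕ} {L : Fin n → Label n} {C : Finset (Fin n)}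
    (hC : IsFreeCover (G i) L C) :
    ∃ C', IsFreeCover (G (i + 1)) (notifiedLabels (G i) (G (i + 1)) L) C' ∧
      C'.card ≤ C.card + 2 * (changedEdges G (i + 1)).ncard := by
  classical
  set F := (changedEdges G (i + 1)).toFinite.toFinset with hF
  have hF' : ∀ e, e ∈ F ↔ e ∈ changedEdges G (i + 1) := fun e => Set.Finite.mem_toFinset _
  set E := F.biUnion Sym2.toFinset with hE
  have hmem : ∀ a b, ¬ ((G (i + 1)).Adj a b ↔ (G i).Adj a b) → a ∈ E := fun a b h =>
    Finset.mem_biUnion.2 ⟨s(a, b), (hF' _).2 (mem_changedEdges_succ.2 h), by simp⟩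
  refine ⟨C ∪ E, ?_, ?_⟩
  · have hfree : ∀ a, notifiedLabels (G i) (G (i + 1)) L a = Label.unmatched →
        a ∈ E ∨ L a = Label.unmatched := by
      intro a ha
      by_cases h : ∀ b, (G (i + 1)).Adj a b ↔ (G i).Adj a b
      · exact Or.inr (by rwa [notifiedLabels_of_adj_iff h] at ha)
      · push Not at h
        obtain ⟨b, hb⟩ := h
        exact Or.inl (hmem a b (by tauto))
    rintro v u ⟨hadj, hv, hu⟩
    simp only [Finset.mem_union]
    by_cases hadj' : (G i).Adj v u
    · rcases hfree v hv with h | hv'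
      · exact Or.inl (Or.inr h)
      · rcases hfree u hu with h | hu'
        · exact Or.inr (Or.inr h)
        · exact (hC v u ⟨hadj', hv', hu'⟩).imp Or.inl Or.inl
    · exact Or.inl (Or.inr (hmem v u (by tauto)))
  · refine (Finset.card_union_le _ _).trans (Nat.add_le_add_left ?_ _)
    rw [Set.ncard_eq_toFinset_card _ (Set.toFinite _), mul_comm]
    refine Finset.card_biUnion_le_card_mul _ _ _ fun e _ => ?_
    induction e with
    | _ a b => rw [Sym2.toFinset_mk_eq]; exact Finset.card_le_two

lemma IsFreeEdge.of_labels_succ {i : ℕ} {v u : Fin n}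
    (h : IsFreeEdge (G (i + 1)) ((rotating n).labels G L₀ (i + 1)) v u) :
    IsFreeEdge (G (i + 1))
      (notifiedLabels (G i) (G (i + 1)) ((rotating n).labels G L₀ i)) v u := by
  refine ⟨h.1, by_contra fun hne => hne ?_, by_contra fun hne => hne ?_⟩
  · exact (runRound_fst_of_notifiedLabels_ne hne).symm.trans h.2.1
  · exact (runRound_fst_of_notifiedLabels_ne hne).symm.trans h.2.2

lemma IsFreeCover.labels_succ {i : ℕ} {C : Finset (Fin n)}
    (hC : IsFreeCover (G (i + 1))
      (notifiedLabels (G i) (G (i + 1)) ((rotating n).labels G L₀ i)) C) :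
    IsFreeCover (G (i + 1)) ((rotating n).labels G L₀ (i + 1)) C :=
  fun v u h => hC v u h.of_labels_succ

/-- A match decreases the size of a cover of the edges between unmatched nodes. -/
lemma IsMutual.exists_isFreeCover {i : ℕ} (hi : Even (i + 1)) {v u : Fin n}
    (h : IsMutual (i + 1) (G i) (G (i + 1)) ((rotating n).config G L₀ i) v u)
    {C : Finset (Fin n)} (hC : IsFreeCover (G (i + 1))
      (notifiedLabels (G i) (G (i + 1)) ((rotating n).labels G L₀ i)) C) :
    ∃ C', IsFreeCover (G (i + 1)) ((rotating n).labels G L₀ (i + 1)) C' ∧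
      C'.card + 1 ≤ C.card := by
  -- The mutual edge is free, so the cover contains one of its ends; once matched, that end covers
  -- no free edge and can be erased.
  wlog hv : v ∈ C generalizing v u
  · exact this h.symm ((hC v u h.1).resolve_left hv)
  have hne : ∀ x, (rotating n).labels G L₀ (i + 1) x = Label.unmatched → x ≠ v := by
    rintro x hx rfl
    rw [DynamicMatching.labels_succ, h.runRound_fst hi] at hx
    cases hx
  refine ⟨C.erase v, fun x y hxy => ?_, (Finset.card_erase_add_one hv).le⟩
  simp only [Finset.mem_erase]
  exact (hC.labels_succ x y hxy).imp (fun h => ⟨hne x hxy.2.1, h⟩) fun h => ⟨hne y hxy.2.2, h⟩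

/-- Take the highest-priority node on a free edge. Each free neighbor stores only nodes that lie on
free edges, so it chooses this one. -/
lemma exists_isMutual_of_quiet {i : ℕ} (hi : ¬ Even i) (hG : G (i + 1) = G i)
    (hfree : ∃ v u, IsFreeEdge (G i) ((rotating n).labels G L₀ i) v u) :
    ∃ v u, IsMutual (i + 1) (G i) (G (i + 1)) ((rotating n).config G L₀ i) v u := by
  obtain ⟨v, ⟨u, hu⟩, hv⟩ := Set.exists_max_image
    {v | ∃ u, IsFreeEdge (G i) ((rotating n).labels G L₀ i) v u} (priority (i + 1))
    (Set.toFinite _) hfree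
  refine ⟨v, exists_isMutual hu.2.1 ?_ ?_⟩
  · rw [config_snd_of_odd hi]
    exact ⟨u, hu.1.symm, hu.2.2⟩
  · intro w hw
    rw [config_snd_of_odd hi] at hw ⊢
    exact ⟨hG ▸ hw.1.symm, hw.2, ⟨hw.1.symm, hu.2.1⟩, fun x hx => hv x ⟨w, hx.1, hx.2, hw.2⟩⟩

lemma incorrect_succ_le (A : Algorithm n) (i : ℕ) :
    incorrect A G L₀ (i + 1) ≤ incorrect A G L₀ i + 1 := by
  refine (Set.ncard_le_ncard ?_ (((Set.finite_le_nat i).subset fun _ h => h.1).insert _)).trans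
    (Set.ncard_insert_le (i + 1) _)
  rintro j ⟨hj, h⟩
  rcases Nat.le_succ_iff.1 hj with h' | rfl
  · exact Or.inr ⟨h', h⟩
  · exact Or.inl rfl

lemma incorrect_succ_eq (A : Algorithm n) {i : ℕ}
    (h : ∀ v, ¬ InconsistentInRound A G L₀ (i + 1) v) :
    incorrect A G L₀ (i + 1) = incorrect A G L₀ i := by
  refine congrArg Set.ncard (Set.ext fun j => ⟨?_, fun hj => ⟨hj.1.trans i.le_succ, hj.2⟩⟩)
  rintro ⟨hj, v, hv⟩
  rcases Nat.le_succ_iff.1 hj with h' | rfl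
  · exact ⟨h', v, hv⟩
  · exact absurd hv (h v)

/-- In a round without topology changes, consistent stars remain consistent. -/
lemma not_inconsistentInRound_of_quiet (h0 : ∀ v, StarConsistent (G 0) L₀ v) {i : ℕ}
    (hF : (changedEdges G (i + 1)).ncard = 0)
    (h : ∀ v u, ¬ IsFreeEdge (G i) ((rotating n).labels G L₀ i) v u) (v : Fin n) :
    ¬ InconsistentInRound (rotating n) G L₀ (i + 1) v := by
  have hc := ((isValid_labels h0 i).starConsistent_iff v).2 (h v)
  have ht : ¬ TouchedInRound G (i + 1) v := by
    rintro ⟨e, he, -⟩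
    rw [(Set.ncard_eq_zero (Set.toFinite _)).1 hF] at he
    exact he
  rintro (h' | h')
  · exact h' (hc.congr (adj_iff_of_not_touched ht))
  · exact h' (starConsistent_succ h0 hc ht)

-- Each cover node pays for the two rounds of a phase. The parity term is a loan for the announcing
-- round, repaid by the match in the next round if that round is quiet.
open Classical in
lemma exists_isFreeCover (h0 : ∀ v, StarConsistent (G 0) L₀ v) (i : ℕ) :
    ∃ C, IsFreeCover (G i) ((rotating n).labels G L₀ i) C ∧
      incorrect (rotating n) G L₀ i + 2 * C.card ≤ 6 * changes G i +
        if ¬ Even i ∧ ∃ v u, IsFreeEdge (G i) ((rotating n).labels G L₀ i) v u then 1 else 0 := by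
  induction i with
  | zero =>
    refine ⟨∅, fun v u h => absurd h (((isValid_labels h0 0).starConsistent_iff v).1 (h0 v) u), ?_⟩
    have : incorrect (rotating n) G L₀ 0 = 0 := by
      rw [incorrect, Set.ncard_eq_zero ((Set.finite_le_nat 0).subset fun _ h => h.1)]
      refine Set.eq_empty_of_forall_notMem ?_
      rintro j ⟨hj, v, hv⟩
      obtain rfl := Nat.le_zero.1 hj
      exact hv.elim (fun h => h (h0 v)) fun h => h (h0 v)
    simp [this]
  | succ i ih =>
    obtain ⟨C, hC, hcard⟩ := ih
    obtain ⟨C', hC', hcard'⟩ := hC.exists_notifiedLabels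
    have hinc := incorrect_succ_le (G := G) (L₀ := L₀) (rotating n) i
    rw [changes_succ]
    by_cases hF : (changedEdges G (i + 1)).ncard = 0
    swap
    -- With `f ≥ 1` changes the left side grows by at most `1 + 4 * f` and a loan of `1` may expire;
    -- `6 * f` covers both.
    · refine ⟨C', hC'.labels_succ, ?_⟩
      split_ifs at hcard <;> omega
    have hG := eq_of_ncard_changedEdges_eq_zero hF
    by_cases hfree : ∃ v u, IsFreeEdge (G i) ((rotating n).labels G L₀ i) v u
    swap
    · refine ⟨C', hC'.labels_succ, ?_⟩
      rw [if_neg fun h => hfree h.2] at hcard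
      push Not at hfree
      rw [incorrect_succ_eq _ (not_inconsistentInRound_of_quiet h0 hF hfree)]
      omega
    by_cases hi : Even i
    · have hodd : ¬ Even (i + 1) := fun h => Nat.even_add_one.1 h hi
      have hfree' : ∃ v u, IsFreeEdge (G (i + 1)) ((rotating n).labels G L₀ (i + 1)) v u := by
        have : (rotating n).labels G L₀ (i + 1) = (rotating n).labels G L₀ i := by
          funext v
          rw [labels_succ_of_odd hodd, hG, notifiedLabels_self]
        rwa [this, hG]
      refine ⟨C', hC'.labels_succ, ?_⟩
      rw [if_pos ⟨hodd, hfree'⟩]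
      rw [if_neg fun h => h.1 hi] at hcard
      omega
    · obtain ⟨v, u, hvu⟩ := exists_isMutual_of_quiet hi hG hfree
      obtain ⟨C'', hC'', hlt⟩ := hvu.exists_isFreeCover (Nat.even_add_one.2 hi) hC'
      -- The round costs `1`, the loan expires, and the smaller cover releases `2`.
      refine ⟨C'', hC'', ?_⟩
      split_ifs at hcard <;> omega

theorem amortizedAtMost_rotating (h0 : ∀ v, StarConsistent (G 0) L₀ v) :
    AmortizedAtMost (rotating n) G L₀ 7 := by
  intro i hi
  obtain ⟨C, -, hC⟩ := exists_isFreeCover h0 i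
  rw [div_le_iff₀ (by exact_mod_cast hi)]
  -- The parity term is at most `1`, hence at most `changes G i`.
  have : incorrect (rotating n) G L₀ i ≤ 7 * changes G i := by
    split_ifs at hC <;> omega
  exact_mod_cast this

end Execution

theorem messagesAtMost_rotating (n : ℕ) : (rotating n).MessagesAtMost (1 * Nat.log 2 n) := by
  intro r v s w
  simp only [rotating]
  split_ifs with h
  · rw [one_mul]
    exact Nat.log_pos one_lt_two h.1
  · simp

end DynamicMatching

theorem mainTheorem3 :
    ∃ (A : ∀ n : ℕ, DynamicMatching.Algorithm n) (c k K : ℕ), ∀ n : ℕ,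
      (A n).MessagesAtMost (c * Nat.log 2 n) ∧
      ∀ (G : ℕ → SimpleGraph (Fin n)) (L₀ : Fin n → DynamicMatching.Label n),
        (∀ v, DynamicMatching.StarConsistent (G 0) L₀ v) →
        DynamicMatching.AmortizedAtMost (A n) G L₀ k ∧
        DynamicMatching.WorstCaseAtMost (A n) G L₀ (K * n) ∧
        DynamicMatching.ConsistentStarsPersist (A n) G L₀ :=
  ⟨DynamicMatching.rotating, 1, 7, 3, fun n => ⟨DynamicMatching.messagesAtMost_rotating n,
    fun _ _ h0 => ⟨DynamicMatching.amortizedAtMost_rotating h0,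
      DynamicMatching.worstCaseAtMost_rotating h0,
      DynamicMatching.consistentStarsPersist_rotating h0⟩⟩⟩
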